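/- Let $\mathcal X$, $\mathcal U$, $\mathcal Y$ be complex Pontryagin spaces with indefinite inner products $\langle\cdot,\cdot\rangle$, let $\kappa$ be the (finite) negative index of $\mathcal X$, and assume that $\mathcal U$ and $\mathcal Y$ have the same negative index. Let $\Sigma=(A,B,C,D;\mathcal X,\mathcal U,\mathcal Y;\kappa)$ be a passive system, that is, $A\in\mathcal L(\mathcal X)$, $B\in\mathcal L(\mathcal U,\mathcal X)$, $C\in\mathcal L(\mathcal X,\mathcal Y)$, $D\in\mathcal L(\mathcal U,\mathcal Y)$ are bounded and the system operator $$T=\begin{pmatrix}A&B\\ C&D\end{pmatrix}:\mathcal X\oplus\mathcal U\to\mathcal X\oplus\mathcal Y$$ is a contraction for the indefinite inner products: $\langle Tx,Tx\rangle\le\langle x,x\rangle$ for all $x$. Let $$\theta(z)=D+zC(I-zA)^{-1}B,\qquad z\in\Omega:=\{z\in\mathbb C: |z|<1,\ I-zA \text{ is invertible}\}$$ be the transfer function of $\Sigma$. Then there is an integer $0\le\kappa'\le\kappa$ such that $\theta$ belongs to the generalized Schur class $\mathbf S_{\kappa'}(\mathcal U,\mathcal Y)$. That is, $\Omega$ is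 an open neighbourhood of $0$, $\theta:\Omega\to\mathcal L(\mathcal U,\mathcal Y)$ is holomorphic, and the kernel $$K_\theta(w,z)=\frac{1-\theta(z)\theta(w)^*}{1-z\overline w},\qquad w,z\in\Omega$$ (with $^*$ the adjoint for the indefinite inner products), has $\kappa'$ negative squares: for all $n$, $w_1,\dots,w_n\in\Omega$ and $f_1,\dots,f_n\in\mathcal Y$, the Hermitian matrix $\left(\langle K_\theta(w_j,w_i)f_j,f_i\rangle_{\mathcal Y}\right)_{i,j=1}^n$ has at most $\kappa'$ negative eigenvalues, counted with multiplicity, and at least one such matrix has exactly $\kappa'$ negative eigenvalues. -/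

import Mathlib

noncomputable section

/-- A complex Pontryagin space: a vector space with an indefinite inner product, given through a
fundamental decomposition `X = X₊ ⊕ X₋` with `dim X₋ < ∞`. The Hilbert space inner product is the
one induced by the decomposition (it defines the strong topology), and `J` is the fundamental
symmetry, equal to `1` on `X₊` and to `-1` on `X₋`. -/
class PontryaginSpace (X : Type*) [NormedAddCommGroup X] [InnerProductSpace ℂ X]
    extends CompleteSpace X where
  /-- the fundamental symmetry -/
  J : X →L[ℂ] X
  J_J : ∀ x, J (J x) = x
  inner_J : ∀ x y, inner ℂ (J x) y = inner ℂ x (J y)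
  finite_neg : FiniteDimensional ℂ (Module.End.eigenspace (J : X →ₗ[ℂ] X) (-1))

namespace PontryaginSpace

variable {X U Y : Type*}
  [NormedAddCommGroup X] [InnerProductSpace ℂ X] [PontryaginSpace X]
  [NormedAddCommGroup U] [InnerProductSpace ℂ U] [PontryaginSpace U]
  [NormedAddCommGroup Y] [InnerProductSpace ℂ Y] [PontryaginSpace Y]

/-- The indefinite inner product `⟨x, y⟩`, linear in `x` and conjugate linear in `y`. -/
def form (x y : X) : ℂ := inner ℂ y (J x)

lemma conj_form (x y : X) : (starRingEnd ℂ) (form x y) = form y x := by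
  simp only [form, inner_conj_symm, inner_J]

/-- The negative index `dim X₋`. -/
def negIndex (X : Type*) [NormedAddCommGroup X] [InnerProductSpace ℂ X] [PontryaginSpace X] : ℕ :=
  Module.finrank ℂ (Module.End.eigenspace (J : X →L[ℂ] X).toLinearMap (-1))

/-- The adjoint of a bounded operator with respect to the indefinite inner products. -/
def adj (T : X →L[ℂ] Y) : Y →L[ℂ] X := J ∘L (ContinuousLinearMap.adjoint T) ∘L J

lemma form_adj (T : X →L[ℂ] Y) (x : X) (y : Y) : form (T x) y = form x (adj T y) := by
  simp only [form, adj, ContinuousLinearMap.comp_apply, inner_J, J_J]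
  rw [← inner_J, ContinuousLinearMap.adjoint_inner_left]

lemma form_adj' (T : X →L[ℂ] Y) (x : X) (y : Y) : form (adj T y) x = form y (T x) := by
  rw [← conj_form, ← form_adj, conj_form]

/-- `T` is a contraction with respect to the indefinite inner products; the numbers `⟨x, x⟩`
are real. -/
def IsContraction (T : X →L[ℂ] Y) : Prop := ∀ x, (form (T x) (T x)).re ≤ (form x x).re

/-- The direct orthogonal sum `X ⊕ U` of two Pontryagin spaces. -/
instance instProd : PontryaginSpace (WithLp 2 (X × U)) where
  J := (WithLp.prodContinuousLinearEquiv 2 ℂ X U).symm.toContinuousLinearMap ∘L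
    ((J : X →L[ℂ] X).prodMap (J : U →L[ℂ] U)) ∘L
    (WithLp.prodContinuousLinearEquiv 2 ℂ X U).toContinuousLinearMap
  J_J := by
    intro x
    have h : Prod.map (J : X → X) (J : U → U) (Prod.map (J : X → X) (J : U → U) x.ofLp) = x.ofLp :=
      Prod.ext (J_J _) (J_J _)
    simp [h]
  inner_J := by
    intro x y
    simp [WithLp.prod_inner_apply, inner_J]
  finite_neg := by
    have := finite_neg (X := X)
    have := finite_neg (X := U)
    let EX := Module.End.eigenspace (J : X →L[ℂ] X).toLinearMap (-1)
    let EU := Module.End.eigenspace (J : U →L[ℂ] U).toLinearMap (-1)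
    let g : (EX × EU) →ₗ[ℂ] WithLp 2 (X × U) :=
      (WithLp.linearEquiv 2 ℂ (X × U)).symm.toLinearMap ∘ₗ EX.subtype.prodMap EU.subtype
    refine Submodule.finiteDimensional_of_le (S₂ := LinearMap.range g) ?_
    intro x hx
    rw [Module.End.mem_eigenspace_iff] at hx
    have h1 : J x.fst = -x.fst := by simpa using congrArg (fun v => v.fst) hx
    have h2 : J x.snd = -x.snd := by simpa using congrArg (fun v => v.snd) hx
    refine ⟨(⟨x.fst, ?_⟩, ⟨x.snd, ?_⟩), ?_⟩
    · rw [Module.End.mem_eigenspace_iff]; simpa using h1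
    · rw [Module.End.mem_eigenspace_iff]; simpa using h2
    · rfl

end PontryaginSpace

open PontryaginSpace

/-- An operator colligation, or linear system, with state space `X`, incoming space `U` and
outgoing space `Y`. -/
structure Colligation (X U Y : Type*)
    [NormedAddCommGroup X] [InnerProductSpace ℂ X] [PontryaginSpace X]
    [NormedAddCommGroup U] [InnerProductSpace ℂ U] [PontryaginSpace U]
    [NormedAddCommGroup Y] [InnerProductSpace ℂ Y] [PontryaginSpace Y] where
  /-- the main operator -/
  A : X →L[ℂ] X
  /-- the control operator -/
  B : U →L[ℂ] X
  /-- the observation operator -/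
  C : X →L[ℂ] Y
  /-- the feedthrough operator -/
  D : U →L[ℂ] Y

namespace Colligation

variable {X U Y : Type*}
  [NormedAddCommGroup X] [InnerProductSpace ℂ X] [PontryaginSpace X]
  [NormedAddCommGroup U] [InnerProductSpace ℂ U] [PontryaginSpace U]
  [NormedAddCommGroup Y] [InnerProductSpace ℂ Y] [PontryaginSpace Y]

/-- The system operator `T (x, u) = (A x + B u, C x + D u)` from `X ⊕ U` to `X ⊕ Y`. -/
def systemOperator (σ : Colligation X U Y) : WithLp 2 (X × U) →L[ℂ] WithLp 2 (X × Y) :=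
  (WithLp.prodContinuousLinearEquiv 2 ℂ X Y).symm.toContinuousLinearMap ∘L
    ((σ.A.coprod σ.B).prod (σ.C.coprod σ.D)) ∘L
    (WithLp.prodContinuousLinearEquiv 2 ℂ X U).toContinuousLinearMap

/-- A system is passive if its system operator is a contraction for the indefinite inner
products. -/
def IsPassive (σ : Colligation X U Y) : Prop := IsContraction σ.systemOperator

/-- The transfer function `θ(z) = D + z C (I - z A)⁻¹ B`; only its values at those `z` for which
`I - z A` is invertible are meaningful. -/
def transferFunction (σ : Colligation X U Y) (z : ℂ) : U →L[ℂ] Y :=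
  σ.D + z • (σ.C ∘L Ring.inverse (1 - z • σ.A) ∘L σ.B)

/-- The points of the open unit disk at which the transfer function is defined. -/
def transferDomain (σ : Colligation X U Y) : Set ℂ :=
  {z | ‖z‖ < 1 ∧ IsUnit (1 - z • σ.A)}

end Colligation

section Schur

variable {U Y : Type*}
  [NormedAddCommGroup U] [InnerProductSpace ℂ U] [PontryaginSpace U]
  [NormedAddCommGroup Y] [InnerProductSpace ℂ Y] [PontryaginSpace Y]

/-- The Schur kernel `K_S(w, z) = (1 - S(z) S(w)*) / (1 - z w̄)`. -/
def schurKernel (S : ℂ → U →L[ℂ] Y) (w z : ℂ) : Y →L[ℂ] Y :=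
  (1 - z * (starRingEnd ℂ) w)⁻¹ • (1 - S z ∘L adj (S w))

/-- The matrix with entries `⟨K_S(w_j, w_i) f_j, f_i⟩`. -/
def schurMatrix (S : ℂ → U →L[ℂ] Y) {n : ℕ} (w : Fin n → ℂ) (f : Fin n → Y) :
    Matrix (Fin n) (Fin n) ℂ :=
  Matrix.of fun i j => form (schurKernel S (w j) (w i) (f j)) (f i)

lemma schurMatrix_isHermitian (S : ℂ → U →L[ℂ] Y) {n : ℕ} (w : Fin n → ℂ) (f : Fin n → Y) :
    (schurMatrix S w f).IsHermitian := by
  have key : ∀ i j, schurMatrix S w f i j = (1 - w i * (starRingEnd ℂ) (w j))⁻¹ *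
      (form (f j) (f i) - form (adj (S (w j)) (f j)) (adj (S (w i)) (f i))) := by
    intro i j
    rw [← form_adj]
    simp [schurMatrix, schurKernel, form]
  ext i j
  rw [Matrix.conjTranspose_apply, key, key]
  simp only [RCLike.star_def, map_mul, map_inv₀, map_sub, map_one, conj_form, Complex.conj_conj]
  ring

/-- The number of negative eigenvalues, with multiplicity, of the matrix
`(⟨K_S(w_j, w_i) f_j, f_i⟩)`. -/
def schurNegCount (S : ℂ → U →L[ℂ] Y) {n : ℕ} (w : Fin n → ℂ) (f : Fin n → Y) : ℕ :=
  {i | (schurMatrix_isHermitian S w f).eigenvalues i < 0}.ncard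

/-- The kernel `K_S` has `κ` negative squares on `Ω`. -/
def HasNegativeSquares (Ω : Set ℂ) (S : ℂ → U →L[ℂ] Y) (κ : ℕ) : Prop :=
  (∀ (n : ℕ) (w : Fin n → ℂ) (f : Fin n → Y), (∀ i, w i ∈ Ω) → schurNegCount S w f ≤ κ) ∧
  ∃ (n : ℕ) (w : Fin n → ℂ) (f : Fin n → Y), (∀ i, w i ∈ Ω) ∧ schurNegCount S w f = κ

/-- `S`, as a function on the domain `Ω`, belongs to the generalized Schur class `S_κ(U, Y)`:
it is holomorphic on `Ω`, an open neighbourhood of the origin in the unit disk, and its Schur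
kernel has `κ` negative squares on `Ω`. -/
structure IsGeneralizedSchur (Ω : Set ℂ) (S : ℂ → U →L[ℂ] Y) (κ : ℕ) : Prop where
  isOpen : IsOpen Ω
  zero_mem : (0 : ℂ) ∈ Ω
  subset_disk : Ω ⊆ Metric.ball 0 1
  holomorphic : DifferentiableOn ℂ S Ω
  negativeSquares : HasNegativeSquares Ω S κ

end Schur

end

/-!
The argument rests on one observation: a vector whose component in the negative eigenspace of the
fundamental symmetry vanishes is nonnegative for the indefinite inner product
(`form_self_nonneg_of_negPart_eq_zero`). Hence a linear map into a Pontryagin space which sends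
every nonzero vector to a negative vector has a domain of dimension at most the negative index
(`finrank_le_negIndex_of_form_neg`).

*The adjoint of a contraction `T : P → Q` is a contraction if `P` and `Q` have the same negative
index* (`IsContraction.adj`). On `P ⊕ Q` the Hermitian form
`E(x, y) = ⟨x, x⟩ + 2 Re ⟨T x, y⟩ + ⟨y, y⟩` has the two Schur complement decompositions
`E(x, y) = ⟨T x + y, T x + y⟩ + (⟨x, x⟩ - ⟨T x, T x⟩)` and
`E(x, y) = ⟨x + T* y, x + T* y⟩ + (⟨y, y⟩ - ⟨T* y, T* y⟩)`. If `⟨y, y⟩ < ⟨T* y, T* y⟩` for some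
`y`, then by the second one `E` is negative definite on the span of `P₋ × 0` and `(-T* y, y)`, and
by the first one `(x, y) ↦ T x + y` sends this space of dimension `negIndex P + 1` to negative
vectors of `Q`.

*The Schur kernel.* For `w ∈ Ω` and `f ∈ Y` put `x = (C (1 - w A)⁻¹)* f` and `g = (w̄ x, f)`. Then
`T* g = (x, θ(w)* f)` (`adj_systemOperator_apply`), so that the entries of the Schur matrix are
`⟨x_j, x_i⟩ + (⟨g_j, g_i⟩ - ⟨T* g_j, T* g_i⟩) / (1 - w_i w̄_j)`. Since `T*` is a contraction,
expanding the denominator in a geometric series shows that the second summand is positive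
semidefinite. The Schur matrix thus dominates a Gram matrix of vectors of `X`, and has at most
`negIndex X` negative eigenvalues (`card_neg_eigenvalues_le_negIndex`). The number `κ'` is the
maximum of the counts.
-/

open PontryaginSpace ComplexConjugate

noncomputable section

/-! ### The indefinite inner product -/

namespace PontryaginSpace

variable {X U Y : Type*}
  [NormedAddCommGroup X] [InnerProductSpace ℂ X] [PontryaginSpace X]
  [NormedAddCommGroup U] [InnerProductSpace ℂ U] [PontryaginSpace U]
  [NormedAddCommGroup Y] [InnerProductSpace ℂ Y] [PontryaginSpace Y]

lemma form_add_left (x x' y : X) : form (x + x') y = form x y + form x' y := by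
  simp [form]

lemma form_add_right (x y y' : X) : form x (y + y') = form x y + form x y' := by
  simp [form]

lemma form_sub_left (x x' y : X) : form (x - x') y = form x y - form x' y := by
  simp [form]

lemma form_sub_right (x y y' : X) : form x (y - y') = form x y - form x y' := by
  simp [form]

lemma form_smul_left (c : ℂ) (x y : X) : form (c • x) y = c * form x y := by
  simp [form]

lemma form_smul_right (c : ℂ) (x y : X) : form x (c • y) = conj c * form x y := by
  simp [form, mul_comm]

lemma form_sum_left {ι : Type*} (s : Finset ι) (x : ι → X) (y : X) :
    form (∑ i ∈ s, x i) y = ∑ i ∈ s, form (x i) y := by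
  simp [form]

lemma form_sum_right {ι : Type*} (s : Finset ι) (x : X) (y : ι → X) :
    form x (∑ i ∈ s, y i) = ∑ i ∈ s, form x (y i) := by
  simp [form]

lemma form_prod (p q : WithLp 2 (X × U)) :
    form p q = form p.fst q.fst + form p.snd q.snd := by
  simp only [form, WithLp.prod_inner_apply]
  rfl

lemma re_form_comm (x y : X) : (form x y).re = (form y x).re := by
  rw [← conj_form, Complex.conj_re]

lemma re_form_smul_self (c : ℂ) (x : X) :
    (form (c • x) (c • x)).re = Complex.normSq c * (form x x).re := by
  rw [form_smul_left, form_smul_right, ← mul_assoc, Complex.mul_conj, Complex.re_ofReal_mul]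

lemma eq_of_forall_form_eq {a b : X} (h : ∀ x, form x a = form x b) : a = b := by
  refine ext_inner_right ℂ fun v => ?_
  simpa [form, J_J] using h (J v)

lemma form_sum_smul_self {ι : Type*} (s : Finset ι) (c : ι → ℂ) (x : ι → X) :
    form (∑ j ∈ s, c j • x j) (∑ i ∈ s, c i • x i) =
      ∑ i ∈ s, ∑ j ∈ s, conj (c i) * (form (x j) (x i) * c j) := by
  simp only [form_sum_right, form_sum_left, form_smul_left, form_smul_right]
  refine Finset.sum_congr rfl fun i _ => ?_
  rw [Finset.mul_sum]
  exact Finset.sum_congr rfl fun j _ => by ring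

/-! ### The negative index -/

/-- The negative eigenspace `X₋` of the fundamental symmetry. -/
abbrev negSpace (X : Type*) [NormedAddCommGroup X] [InnerProductSpace ℂ X] [PontryaginSpace X] :
    Submodule ℂ X :=
  Module.End.eigenspace (J : X →L[ℂ] X).toLinearMap (-1)

instance : FiniteDimensional ℂ (negSpace X) := finite_neg

lemma mem_negSpace {x : X} : x ∈ negSpace X ↔ J x = -x := by
  simp [negSpace]

/-- The projection `(1 - J) / 2` onto the negative eigenspace of the fundamental symmetry. -/
def negPart : X →ₗ[ℂ] negSpace X :=
  ((2⁻¹ : ℂ) • (LinearMap.id - (J : X →L[ℂ] X).toLinearMap)).codRestrict _ fun x => by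
    rw [mem_negSpace]
    simp [J_J, ← smul_neg]

lemma form_self_nonneg_of_negPart_eq_zero {x : X} (hx : negPart x = 0) :
    0 ≤ (form x x).re := by
  have h : (2⁻¹ : ℂ) • (x - J x) = 0 := congrArg Subtype.val hx
  have h' : J x = x := (sub_eq_zero.1 ((smul_eq_zero.1 h).resolve_left (by norm_num))).symm
  rw [form, h']
  exact inner_self_nonneg (𝕜 := ℂ)

lemma form_self_neg_of_mem_negSpace {x : X} (hx : x ∈ negSpace X) (h0 : x ≠ 0) :
    (form x x).re < 0 := by
  rw [form, mem_negSpace.1 hx, inner_neg_right, Complex.neg_re, neg_lt_zero]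
  exact (inner_self_nonneg (𝕜 := ℂ)).lt_of_ne fun h => h0 (by
    rw [← norm_eq_zero, ← sq_eq_zero_iff, ← inner_self_eq_norm_sq (𝕜 := ℂ)]
    exact h.symm)

/-- A subspace of negative vectors has dimension at most the negative index; here the subspace is
given as the image of a linear map. -/
lemma finrank_le_negIndex_of_form_neg {V : Type*} [AddCommGroup V] [Module ℂ V]
    [FiniteDimensional ℂ V] (L : V →ₗ[ℂ] X) (hL : ∀ v ≠ 0, (form (L v) (L v)).re < 0) :
    Module.finrank ℂ V ≤ negIndex X := by
  refine LinearMap.finrank_le_finrank_of_injective (f := negPart ∘ₗ L) ?_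
  rw [← LinearMap.ker_eq_bot, LinearMap.ker_eq_bot']
  intro v hv
  by_contra h0
  exact (hL v h0).not_ge (form_self_nonneg_of_negPart_eq_zero hv)

lemma negIndex_prod : negIndex (WithLp 2 (X × U)) = negIndex X + negIndex U := by
  have key (p : WithLp 2 (X × U)) :
      p ∈ negSpace (WithLp 2 (X × U)) ↔ p.fst ∈ negSpace X ∧ p.snd ∈ negSpace U := by
    simp only [mem_negSpace]
    exact (WithLp.ofLp_injective 2).eq_iff.symm.trans Prod.ext_iff
  let e : negSpace (WithLp 2 (X × U)) ≃ₗ[ℂ] negSpace X × negSpace U :=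
    { toFun := fun p => (⟨p.1.fst, ((key _).1 p.2).1⟩, ⟨p.1.snd, ((key _).1 p.2).2⟩)
      invFun := fun q => ⟨WithLp.toLp 2 (q.1.1, q.2.1), (key _).2 ⟨q.1.2, q.2.2⟩⟩
      map_add' := fun _ _ => rfl
      map_smul' := fun _ _ => rfl
      left_inv := fun _ => rfl
      right_inv := fun _ => rfl }
  exact e.finrank_eq.trans (Module.finrank_prod ..)

/-! ### Adjoints of contractions -/

theorem IsContraction.adj {T : X →L[ℂ] Y} (hT : IsContraction T)
    (hXY : negIndex X = negIndex Y) : IsContraction (PontryaginSpace.adj T) := by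
  intro y
  by_contra! hy
  set s := PontryaginSpace.adj T y with hs
  -- The map `(x, y) ↦ T x + y` on the span of `X₋ × 0` and `(-T* y, y)`.
  let L : negSpace X × ℂ →ₗ[ℂ] Y :=
    (T.toLinearMap ∘ₗ (negSpace X).subtype).coprod (LinearMap.toSpanSingleton ℂ Y (y - T s))
  have hL (v : negSpace X × ℂ) (hv : v ≠ 0) : (form (L v) (L v)).re < 0 := by
    obtain ⟨⟨a, ha⟩, c⟩ := v
    have hLv : L (⟨a, ha⟩, c) = T (a - c • s) + c • y := by
      simp only [L, LinearMap.coprod_apply, LinearMap.comp_apply, Submodule.subtype_apply,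
        LinearMap.toSpanSingleton_apply, ContinuousLinearMap.coe_coe, map_sub, map_smul, smul_sub]
      abel
    rw [hLv]
    -- Equality of the two Schur complement decompositions, with `x = a - c T* y`.
    have hE : (form (T (a - c • s) + c • y) (T (a - c • s) + c • y)).re =
        (form (T (a - c • s)) (T (a - c • s))).re - (form (a - c • s) (a - c • s)).re
          + (form a a).re + Complex.normSq c * ((form y y).re - (form s s).re) := by
      have h1 : form (T (a - c • s)) (c • y) = form (a - c • s) (c • s) := by
        rw [form_smul_right, form_smul_right, form_adj]
      have h2 := congrArg Complex.re h1
      have h3 := re_form_comm (c • y) (T (a - c • s))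
      have h4 := re_form_comm (c • s) a
      have h5 := re_form_smul_self c s
      have h6 := re_form_smul_self c y
      simp only [form_add_left, form_add_right, Complex.add_re]
      simp only [form_sub_left, form_sub_right, Complex.sub_re] at h2 ⊢
      linarith
    have hTx := hT (a - c • s)
    rw [hE]
    by_cases h0 : a = 0
    · have hc : c ≠ 0 := by
        rintro rfl
        exact hv (by simp [h0])
      have := mul_neg_of_pos_of_neg (Complex.normSq_pos.2 hc) (sub_neg.2 hy)
      have : (form a a).re = 0 := by simp [h0, form]
      linarith
    · have := mul_nonpos_of_nonneg_of_nonpos (Complex.normSq_nonneg c) (sub_neg.2 hy).le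
      have := form_self_neg_of_mem_negSpace ha h0
      linarith
  have := finrank_le_negIndex_of_form_neg L hL
  rw [Module.finrank_prod, Module.finrank_self] at this
  have hX : Module.finrank ℂ (negSpace X) = negIndex X := rfl
  omega

/-! ### Negative eigenvalues of Hermitian matrices -/

/-- A Hermitian matrix which dominates the Gram matrix of `x` has at most `negIndex X` negative
eigenvalues. -/
lemma card_neg_eigenvalues_le_negIndex {n : Type*} [Fintype n] [DecidableEq n]
    {M : Matrix n n ℂ} (hM : M.IsHermitian) (x : n → X)
    (h : ∀ c : n → ℂ, (form (∑ j, c j • x j) (∑ j, c j • x j)).re ≤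
      (∑ i, ∑ j, conj (c i) * (M i j * c j)).re) :
    {i | hM.eigenvalues i < 0}.ncard ≤ negIndex X := by
  classical
  let b := hM.eigenvectorBasis
  let I := {i | hM.eigenvalues i < 0}
  -- The linear combinations of the eigenvectors with negative eigenvalue.
  let V : (I → ℂ) →ₗ[ℂ] EuclideanSpace ℂ n := Fintype.linearCombination ℂ fun i : I => b i
  let L : EuclideanSpace ℂ n →ₗ[ℂ] X :=
    Fintype.linearCombination ℂ x ∘ₗ (WithLp.linearEquiv 2 ℂ (n → ℂ)).toLinearMap
  have hcard : Module.finrank ℂ (I → ℂ) = I.ncard := by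
    rw [Module.finrank_fintype_fun_eq_card, ← Nat.card_eq_fintype_card, Nat.card_coe_set_eq]
  rw [← hcard]
  refine finrank_le_negIndex_of_form_neg (L ∘ₗ V) fun a ha => ?_
  have hLV : (L ∘ₗ V) a = ∑ j, V a j • x j := rfl
  rw [hLV]
  refine (h (V a)).trans_lt ?_
  have hq : ∑ i, ∑ j, conj (V a i) * (M i j * V a j) =
      inner ℂ (V a) (WithLp.toLp 2 (M.mulVec (V a).ofLp)) := by
    simp only [PiLp.inner_apply, Matrix.mulVec, dotProduct, RCLike.inner_apply]
    refine Finset.sum_congr rfl fun i _ => ?_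
    rw [← Finset.mul_sum, mul_comm]
  have hVa : V a = ∑ i : I, a i • b i := by simp [V, Fintype.linearCombination_apply]
  have hMV : WithLp.toLp 2 (M.mulVec (V a).ofLp) =
      ∑ i : I, (a i * (hM.eigenvalues i : ℂ)) • b i := by
    have hlin : ∀ v : EuclideanSpace ℂ n, WithLp.toLp 2 (M.mulVec v.ofLp) =
        Matrix.toEuclideanLin M v := fun v => rfl
    have heig : ∀ i, Matrix.toEuclideanLin M (b i) = (hM.eigenvalues i : ℂ) • b i := by
      intro i
      rw [← hlin, hM.mulVec_eigenvectorBasis]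
      rfl
    rw [hlin, hVa, map_sum]
    exact Finset.sum_congr rfl fun i _ => by rw [map_smul, heig, smul_smul]
  have hb : Orthonormal ℂ fun i : I => b i := b.orthonormal.comp _ Subtype.val_injective
  rw [hq, hMV, hVa, hb.inner_sum, Complex.re_sum]
  have hterm (i : I) : (conj (a i) * (a i * (hM.eigenvalues i : ℂ))).re =
      Complex.normSq (a i) * hM.eigenvalues i := by
    rw [← mul_assoc, ← Complex.normSq_eq_conj_mul_self, Complex.re_ofReal_mul, Complex.ofReal_re]
  simp only [hterm]
  obtain ⟨k, hk⟩ := Function.ne_iff.1 ha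
  exact Finset.sum_neg' (fun i _ => mul_nonpos_of_nonneg_of_nonpos (Complex.normSq_nonneg _) i.2.le)
    ⟨k, Finset.mem_univ k, mul_neg_of_pos_of_neg (Complex.normSq_pos.2 hk) k.2⟩

/-- If `S` is a contraction, then the kernel `(⟨g_j, g_i⟩ - ⟨S g_j, S g_i⟩) / (1 - w_i w̄_j)` is
positive semidefinite on the open unit disk, being a sum over `k` of the positive semidefinite
kernels obtained from the vectors `w̄_j ^ k g_j`. -/
lemma IsContraction.sum_defect_div_nonneg {S : X →L[ℂ] Y} (hS : IsContraction S)
    {n : Type*} [Fintype n] (w : n → ℂ) (hw : ∀ i, ‖w i‖ < 1) (g : n → X) (c : n → ℂ) :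
    0 ≤ (∑ i, ∑ j, conj (c i) * ((1 - w i * conj (w j))⁻¹ *
      (form (g j) (g i) - form (S (g j)) (S (g i))) * c j)).re := by
  have hgeom (i j : n) : HasSum (fun k : ℕ => (w i * conj (w j)) ^ k) (1 - w i * conj (w j))⁻¹ := by
    refine hasSum_geometric_of_norm_lt_one ?_
    rw [norm_mul, Complex.norm_conj]
    exact mul_lt_one_of_nonneg_of_lt_one_left (norm_nonneg _) (hw i) (hw j).le
  have hsum := Complex.hasSum_re (hasSum_sum (s := Finset.univ) fun i _ =>
    hasSum_sum (s := Finset.univ) fun j _ =>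
      ((((hgeom i j).mul_right (form (g j) (g i) - form (S (g j)) (S (g i)))).mul_right
        (c j)).mul_left (conj (c i))))
  refine hsum.nonneg fun k => ?_
  have hterm : ∑ i, ∑ j, conj (c i) * ((w i * conj (w j)) ^ k *
      (form (g j) (g i) - form (S (g j)) (S (g i))) * c j) =
      form (∑ j, (c j * conj (w j) ^ k) • g j) (∑ j, (c j * conj (w j) ^ k) • g j) -
      form (S (∑ j, (c j * conj (w j) ^ k) • g j)) (S (∑ j, (c j * conj (w j) ^ k) • g j)) := by
    simp only [map_sum, map_smul, form_sum_smul_self, ← Finset.sum_sub_distrib]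
    refine Finset.sum_congr rfl fun i _ => Finset.sum_congr rfl fun j _ => ?_
    simp only [map_mul, map_pow, Complex.conj_conj]
    ring
  rw [hterm, Complex.sub_re, sub_nonneg]
  exact hS _

end PontryaginSpace

/-! ### Transfer functions -/

namespace Colligation

variable {X U Y : Type*}
  [NormedAddCommGroup X] [InnerProductSpace ℂ X] [PontryaginSpace X]
  [NormedAddCommGroup U] [InnerProductSpace ℂ U] [PontryaginSpace U]
  [NormedAddCommGroup Y] [InnerProductSpace ℂ Y] [PontryaginSpace Y]
  (σ : Colligation X U Y)

lemma isOpen_transferDomain : IsOpen σ.transferDomain := by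
  refine IsOpen.inter (isOpen_lt continuous_norm continuous_const)
    (Units.isOpen.preimage (f := fun z : ℂ => 1 - z • σ.A) (by fun_prop))

lemma zero_mem_transferDomain : (0 : ℂ) ∈ σ.transferDomain := by
  simp [transferDomain]

lemma differentiableOn_transferFunction :
    DifferentiableOn ℂ σ.transferFunction σ.transferDomain := by
  intro z hz
  refine DifferentiableAt.differentiableWithinAt ?_
  obtain ⟨u, hu⟩ := hz.2
  have h1 : DifferentiableAt ℂ (fun z : ℂ => Ring.inverse (1 - z • σ.A)) z := by
    have h2 : DifferentiableAt ℂ Ring.inverse (1 - z • σ.A) :=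
      hu ▸ differentiableAt_inverse u.isUnit
    exact h2.comp z (f := fun z : ℂ => 1 - z • σ.A) (by fun_prop)
  exact (differentiableAt_const _).add (differentiableAt_fun_id.fun_smul
    ((differentiableAt_const _).clm_comp (h1.clm_comp (differentiableAt_const _))))

/-- The vector `x = (C (1 - w A)⁻¹)* f` of the state space. -/
def stateVec (w : ℂ) (f : Y) : X := adj (σ.C ∘L Ring.inverse (1 - w • σ.A)) f

/-- The vector `g = (w̄ x, f)`, where `x = (C (1 - w A)⁻¹)* f`. -/
def graphVec (w : ℂ) (f : Y) : WithLp 2 (X × Y) := WithLp.toLp 2 (conj w • σ.stateVec w f, f)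

lemma adj_systemOperator_apply {w : ℂ} (hw : IsUnit (1 - w • σ.A)) (f : Y) :
    adj σ.systemOperator (σ.graphVec w f) =
      WithLp.toLp 2 (σ.stateVec w f, adj (σ.transferFunction w) f) := by
  refine eq_of_forall_form_eq fun p => ?_
  have hres : w • Ring.inverse (1 - w • σ.A) (σ.A p.fst) + p.fst =
      Ring.inverse (1 - w • σ.A) p.fst := by
    have := congrArg (fun S : X →L[ℂ] X => S p.fst) (Ring.inverse_mul_cancel _ hw)
    simp only [mul_apply_eq_comp, sub_apply,
      one_apply_eq_self, smul_apply, map_sub, map_smul] at this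
    rw [sub_eq_iff_eq_add] at this
    rw [this, add_comm]
  have h1 : (σ.systemOperator p).fst = σ.A p.fst + σ.B p.snd := rfl
  have h2 : (σ.systemOperator p).snd = σ.C p.fst + σ.D p.snd := rfl
  rw [← form_adj, form_prod, form_prod, h1, h2]
  simp only [graphVec, stateVec, WithLp.toLp_fst, WithLp.toLp_snd, form_smul_right, ← form_adj,
    Complex.conj_conj]
  rw [← form_smul_left, ← form_add_left, ← form_add_left]
  congr 1
  simp only [ContinuousLinearMap.comp_apply, transferFunction, add_apply,
    smul_apply]
  rw [← hres]
  simp only [map_add, map_smul, smul_add]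
  abel

lemma form_schurKernel {w z : ℂ} (hw : w ∈ σ.transferDomain) (hz : z ∈ σ.transferDomain)
    (f g : Y) :
    form (schurKernel σ.transferFunction w z f) g =
      form (σ.stateVec w f) (σ.stateVec z g) + (1 - z * conj w)⁻¹ *
        (form (σ.graphVec w f) (σ.graphVec z g) -
          form (adj σ.systemOperator (σ.graphVec w f))
            (adj σ.systemOperator (σ.graphVec z g))) := by
  have hne : 1 - z * conj w ≠ 0 := by
    intro h
    have h1 : ‖z * conj w‖ = 1 := by rw [← sub_eq_zero.1 h, norm_one]
    rw [norm_mul, Complex.norm_conj] at h1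
    exact (mul_lt_one_of_nonneg_of_lt_one_left (norm_nonneg _) hz.1 hw.1.le).ne h1
  have hK : form (schurKernel σ.transferFunction w z f) g = (1 - z * conj w)⁻¹ *
      (form f g - form (adj (σ.transferFunction w) f) (adj (σ.transferFunction z) g)) := by
    rw [schurKernel, smul_apply, form_smul_left,
      sub_apply, form_sub_left, one_apply_eq_self, ContinuousLinearMap.comp_apply,
      form_adj (σ.transferFunction z)]
  rw [hK, σ.adj_systemOperator_apply hw.2, σ.adj_systemOperator_apply hz.2, form_prod, form_prod]
  simp only [graphVec, WithLp.toLp_fst, WithLp.toLp_snd, form_smul_left, form_smul_right,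
    Complex.conj_conj]
  field_simp
  ring

variable {σ}

lemma IsPassive.schurNegCount_le (hσ : σ.IsPassive) (hUY : negIndex U = negIndex Y) {n : ℕ}
    (w : Fin n → ℂ) (f : Fin n → Y) (hw : ∀ i, w i ∈ σ.transferDomain) :
    schurNegCount σ.transferFunction w f ≤ negIndex X := by
  have hadj : IsContraction (adj σ.systemOperator) :=
    IsContraction.adj hσ (by rw [negIndex_prod, negIndex_prod, hUY])
  refine card_neg_eigenvalues_le_negIndex _ (fun i => σ.stateVec (w i) (f i)) fun c => ?_
  have h := hadj.sum_defect_div_nonneg w (fun i => (hw i).1)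
    (fun i => σ.graphVec (w i) (f i)) c
  have hM (i j : Fin n) := σ.form_schurKernel (hw j) (hw i) (f j) (f i)
  simp only [schurMatrix, Matrix.of_apply, hM, add_mul, mul_add, Finset.sum_add_distrib,
    Complex.add_re, form_sum_smul_self]
  exact le_add_of_nonneg_right h

end Colligation

end

theorem mainTheorem6 {X U Y : Type*}
    [NormedAddCommGroup X] [InnerProductSpace ℂ X] [PontryaginSpace X]
    [NormedAddCommGroup U] [InnerProductSpace ℂ U] [PontryaginSpace U]
    [NormedAddCommGroup Y] [InnerProductSpace ℂ Y] [PontryaginSpace Y]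
    (hUY : PontryaginSpace.negIndex U = PontryaginSpace.negIndex Y)
    (κ : ℕ) (hκ : PontryaginSpace.negIndex X = κ)
    (σ : Colligation X U Y) (hσ : σ.IsPassive) :
    ∃ κ' ≤ κ, IsGeneralizedSchur σ.transferDomain σ.transferFunction κ' := by
  subst hκ
  let s : Set ℕ := {m | ∃ (n : ℕ) (w : Fin n → ℂ) (f : Fin n → Y),
    (∀ i, w i ∈ σ.transferDomain) ∧ schurNegCount σ.transferFunction w f = m}
  have hbound : ∀ m ∈ s, m ≤ PontryaginSpace.negIndex X := by
    rintro _ ⟨n, w, f, hw, rfl⟩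
    exact hσ.schurNegCount_le hUY w f hw
  have hbdd : BddAbove s := ⟨_, hbound⟩
  -- The empty family of points shows that `s` is nonempty, so its supremum is attained.
  have hmem : sSup s ∈ s := Nat.sSup_mem ⟨_, 0, 0, 0, fun i => i.elim0, rfl⟩ hbdd
  exact ⟨sSup s, hbound _ hmem, σ.isOpen_transferDomain, σ.zero_mem_transferDomain,
    fun z hz => mem_ball_zero_iff.2 hz.1, σ.differentiableOn_transferFunction,
    fun n w f hw => le_csSup hbdd ⟨n, w, f, hw, rfl⟩, hmem⟩
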